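/- Let $q\neq 9$ be an odd prime power or $q=2$, let $F=GF(q)$, and let $e_1,e_2,e_3$ be the canonical basis of $F^3$. The Paige loop $M^*(q)$ consists of all matrices $\begin{pmatrix} a&\alpha\\ \beta&b\end{pmatrix}$ with $a,b\in F$, $\alpha,\beta\in F^3$ and $ab-\alpha\cdot\beta=1$, where $M$ and $-M$ are identified, with the Zorn multiplication $$\begin{pmatrix} a&\alpha\\ \beta&b\end{pmatrix}\begin{pmatrix} c&\gamma\\ \delta&d\end{pmatrix}=\begin{pmatrix} ac+\alpha\cdot\delta & a\gamma+\alpha d-\beta\times\delta\\ \beta c+b\delta+\alpha\times\gamma & \beta\cdot\gamma+bd\end{pmatrix},$$ where $\cdot$ and $\times$ between vectors denote the dot product and the cross product. Let $\lambda$ be a primitive element of $F$, that is, a generator of the multiplicative group $F\setminus\{0\}$. Then the loop $M^*(q)$ is generated by the three elements $$\begin{pmatrix} 1&e_1\\ 0&1\end{pmatrix},\quad \begin{pmatrix} 1&e_2\\ 0&1\end{pmatrix},\quad \begin{pmatrix} 0&\lambda e_3\\ -\lambda^{-1}e_3&1\end{pmatrix},$$ that is, no proper subloop of $M^*(q)$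 contains all three. -/

import Mathlib

open scoped Matrix

/-- A loop: a set with a binary operation and a two-sided neutral element such that every left and
every right translation is a bijection. -/
class Loop (L : Type*) extends MulOneClass L where
  bijective_mul_left : ∀ a : L, Function.Bijective (fun x => a * x)
  bijective_mul_right : ∀ a : L, Function.Bijective (fun x => x * a)

/-- A subloop: a subset that contains the neutral element and is closed under multiplication and
under both divisions, i.e. under solving `a * x = b` and `x * a = b` for `x`. -/
structure IsSubloop {L : Type*} [Loop L] (S : Set L) : Prop where
  one_mem : 1 ∈ S
  mul_mem : ∀ ⦃a b : L⦄, a ∈ S → b ∈ S → a * b ∈ S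
  left_div_mem : ∀ ⦃a x b : L⦄, a ∈ S → b ∈ S → a * x = b → x ∈ S
  right_div_mem : ∀ ⦃a x b : L⦄, a ∈ S → b ∈ S → x * a = b → x ∈ S

/-- The subloop generated by a subset: the intersection of all subloops that contain it. -/
def subloopClosure {L : Type*} [Loop L] (S : Set L) : Set L :=
  ⋂₀ {T : Set L | IsSubloop T ∧ S ⊆ T}

theorem isSubloop_subloopClosure {L : Type*} [Loop L] (S : Set L) :
    IsSubloop (subloopClosure S) where
  one_mem := fun _ hT => hT.1.one_mem
  mul_mem := fun _ _ ha hb T hT => hT.1.mul_mem (ha T hT) (hb T hT)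
  left_div_mem := fun _ _ _ ha hb h T hT => hT.1.left_div_mem (ha T hT) (hb T hT) h
  right_div_mem := fun _ _ _ ha hb h T hT => hT.1.right_div_mem (ha T hT) (hb T hT) h

/-- Zorn vector matrices `[[a, α], [β, b]]` with scalars `a`, `b` and vectors `α`, `β`. -/
@[ext]
structure ZornMatrix (F : Type*) where
  a : F
  α : Fin 3 → F
  β : Fin 3 → F
  b : F

namespace ZornMatrix

variable {F : Type*} [Field F]

/-- The Zorn multiplication. -/
instance : Mul (ZornMatrix F) where
  mul M N :=
    { a := M.a * N.a + M.α ⬝ᵥ N.β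
      α := M.a • N.α + N.b • M.α - M.β ⨯₃ N.β
      β := N.a • M.β + M.b • N.β + M.α ⨯₃ N.α
      b := M.β ⬝ᵥ N.α + M.b * N.b }

instance : One (ZornMatrix F) where
  one := { a := 1, α := 0, β := 0, b := 1 }

instance : Neg (ZornMatrix F) where
  neg M := { a := -M.a, α := -M.α, β := -M.β, b := -M.b }

/-- The determinant `ab - α · β`. -/
def det (M : ZornMatrix F) : F := M.a * M.b - M.α ⬝ᵥ M.β

/-- The matrix `[[b, -α], [-β, a]]`. -/
def conj (M : ZornMatrix F) : ZornMatrix F :=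
  { a := M.b, α := -M.α, β := -M.β, b := M.a }

theorem mul_def (M N : ZornMatrix F) : M * N =
    { a := M.a * N.a + M.α ⬝ᵥ N.β
      α := M.a • N.α + N.b • M.α - M.β ⨯₃ N.β
      β := N.a • M.β + M.b • N.β + M.α ⨯₃ N.α
      b := M.β ⬝ᵥ N.α + M.b * N.b } := rfl

theorem one_def : (1 : ZornMatrix F) = { a := 1, α := 0, β := 0, b := 1 } := rfl

theorem neg_def (M : ZornMatrix F) :
    -M = { a := -M.a, α := -M.α, β := -M.β, b := -M.b } := rfl

instance : InvolutiveNeg (ZornMatrix F) where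
  neg_neg M := by simp [neg_def]

theorem one_mul' (M : ZornMatrix F) : 1 * M = M := by
  ext <;> simp [mul_def, one_def]

theorem mul_one' (M : ZornMatrix F) : M * 1 = M := by
  ext <;> simp [mul_def, one_def]

theorem neg_mul' (M N : ZornMatrix F) : -M * N = -(M * N) := by
  ext i
  · simp [mul_def, neg_def]
    ring
  · fin_cases i <;> simp [mul_def, neg_def, cross_apply] <;> ring
  · fin_cases i <;> simp [mul_def, neg_def, cross_apply] <;> ring
  · simp [mul_def, neg_def]
    ring

theorem mul_neg' (M N : ZornMatrix F) : M * -N = -(M * N) := by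
  ext i
  · simp [mul_def, neg_def]
    ring
  · fin_cases i <;> simp [mul_def, neg_def, cross_apply] <;> ring
  · fin_cases i <;> simp [mul_def, neg_def, cross_apply] <;> ring
  · simp [mul_def, neg_def]
    ring

theorem det_one : det (1 : ZornMatrix F) = 1 := by
  simp [det, one_def]

theorem det_neg (M : ZornMatrix F) : det (-M) = det M := by
  simp [det, neg_def]

theorem det_conj (M : ZornMatrix F) : det M.conj = det M := by
  simp [det, conj, mul_comm]

theorem det_mul (M N : ZornMatrix F) : det (M * N) = det M * det N := by
  simp [det, mul_def, cross_apply, dotProduct, Fin.sum_univ_three, Matrix.vecHead, Matrix.vecTail]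
  ring

theorem conj_mul_mul (M N : ZornMatrix F) (h : det M = 1) : M.conj * (M * N) = N := by
  simp only [det, dotProduct, Fin.sum_univ_three] at h
  ext i
  · simp [mul_def, conj, cross_apply, dotProduct, Fin.sum_univ_three, Matrix.vecHead,
      Matrix.vecTail]
    linear_combination N.a * h
  · fin_cases i <;> simp [mul_def, conj, cross_apply, dotProduct, Fin.sum_univ_three, Matrix.vecHead,
      Matrix.vecTail]
    · linear_combination N.α 0 * h
    · linear_combination N.α 1 * h
    · linear_combination N.α 2 * h
  · fin_cases i <;> simp [mul_def, conj, cross_apply, dotProduct, Fin.sum_univ_three, Matrix.vecHead,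
      Matrix.vecTail]
    · linear_combination N.β 0 * h
    · linear_combination N.β 1 * h
    · linear_combination N.β 2 * h
  · simp [mul_def, conj, cross_apply, dotProduct, Fin.sum_univ_three, Matrix.vecHead,
      Matrix.vecTail]
    linear_combination N.b * h

theorem mul_mul_conj (M N : ZornMatrix F) (h : det M = 1) : (N * M) * M.conj = N := by
  simp only [det, dotProduct, Fin.sum_univ_three] at h
  ext i
  · simp [mul_def, conj, cross_apply, dotProduct, Fin.sum_univ_three, Matrix.vecHead,
      Matrix.vecTail]
    linear_combination N.a * h
  · fin_cases i <;> simp [mul_def, conj, cross_apply, dotProduct, Fin.sum_univ_three, Matrix.vecHead,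
      Matrix.vecTail]
    · linear_combination N.α 0 * h
    · linear_combination N.α 1 * h
    · linear_combination N.α 2 * h
  · fin_cases i <;> simp [mul_def, conj, cross_apply, dotProduct, Fin.sum_univ_three, Matrix.vecHead,
      Matrix.vecTail]
    · linear_combination N.β 0 * h
    · linear_combination N.β 1 * h
    · linear_combination N.β 2 * h
  · simp [mul_def, conj, cross_apply, dotProduct, Fin.sum_univ_three, Matrix.vecHead,
      Matrix.vecTail]
    linear_combination N.b * h

theorem conj_conj (M : ZornMatrix F) : M.conj.conj = M := by
  simp [conj]

theorem det_upper (v : Fin 3 → F) : det { a := 1, α := v, β := 0, b := 1 } = 1 := by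
  simp [det]

theorem det_mixed (c : Fˣ) (i : Fin 3) :
    det { a := 0, α := Pi.single i (c : F), β := -Pi.single i ((c⁻¹ : Fˣ) : F), b := 1 } = 1 := by
  simp [det]

end ZornMatrix

/-- The Zorn vector matrices of determinant `1`. -/
abbrev UnimodularZorn (F : Type*) [Field F] : Type _ := {M : ZornMatrix F // M.det = 1}

/-- The identification of `M` with `-M`. -/
def paigeSetoid (F : Type*) [Field F] : Setoid (UnimodularZorn F) where
  r M N := M.1 = N.1 ∨ M.1 = -N.1
  iseqv :=
    { refl := fun _ => Or.inl rfl
      symm := by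
        rintro M N (h | h)
        · exact Or.inl h.symm
        · exact Or.inr (by rw [h, neg_neg])
      trans := by
        rintro M N P (h | h) (k | k)
        · exact Or.inl (h.trans k)
        · exact Or.inr (h.trans k)
        · exact Or.inr (by rw [h, k])
        · exact Or.inl (by rw [h, k, neg_neg]) }

/-- The Paige loop over `F`: Zorn vector matrices of determinant `1`, where `M` and `-M` are
identified. -/
def PaigeLoop (F : Type*) [Field F] : Type _ := Quotient (paigeSetoid F)

namespace PaigeLoop

variable {F : Type*} [Field F]

/-- The class of a Zorn vector matrix of determinant `1`. -/
def mk (M : ZornMatrix F) (h : M.det = 1) : PaigeLoop F :=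
  Quotient.mk (paigeSetoid F) ⟨M, h⟩

theorem mk_eq_mk_iff (M N : ZornMatrix F) (hM : M.det = 1) (hN : N.det = 1) :
    mk M hM = mk N hN ↔ M = N ∨ M = -N :=
  Quotient.eq (r := paigeSetoid F)

theorem ind {p : PaigeLoop F → Prop} (h : ∀ M hM, p (mk M hM)) (x : PaigeLoop F) : p x :=
  Quotient.ind (s := paigeSetoid F) (fun M => h M.1 M.2) x

/-- The Zorn multiplication on classes. -/
instance : Mul (PaigeLoop F) where
  mul := Quotient.map₂ (sa := paigeSetoid F) (sb := paigeSetoid F) (sc := paigeSetoid F)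
    (fun M N => ⟨M.1 * N.1, by rw [ZornMatrix.det_mul, M.2, N.2, mul_one]⟩) (by
      rintro M M' (h | h) N N' (k | k)
      · exact Or.inl (show M.1 * N.1 = M'.1 * N'.1 by rw [h, k])
      · exact Or.inr (show M.1 * N.1 = -(M'.1 * N'.1) by rw [h, k, ZornMatrix.mul_neg'])
      · exact Or.inr (show M.1 * N.1 = -(M'.1 * N'.1) by rw [h, k, ZornMatrix.neg_mul'])
      · exact Or.inl (show M.1 * N.1 = M'.1 * N'.1 by rw [h, k, ZornMatrix.neg_mul', ZornMatrix.mul_neg', neg_neg]))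

theorem mk_mul_mk (M N : ZornMatrix F) (hM : M.det = 1) (hN : N.det = 1) :
    mk M hM * mk N hN = mk (M * N) (by rw [ZornMatrix.det_mul, hM, hN, mul_one]) := rfl

instance : One (PaigeLoop F) where
  one := mk 1 ZornMatrix.det_one

theorem one_def : (1 : PaigeLoop F) = mk 1 ZornMatrix.det_one := rfl

instance : Loop (PaigeLoop F) where
  one_mul := ind fun M hM => by simp only [one_def, mk_mul_mk, ZornMatrix.one_mul']
  mul_one := ind fun M hM => by simp only [one_def, mk_mul_mk, ZornMatrix.mul_one']
  bijective_mul_left := ind fun M hM => by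
    have hc : M.conj.det = 1 := by rw [ZornMatrix.det_conj, hM]
    refine Function.bijective_iff_has_inverse.2 ⟨fun x => mk M.conj hc * x, ?_, ?_⟩
    · refine ind fun N hN => ?_
      simp only [mk_mul_mk, ZornMatrix.conj_mul_mul M N hM]
    · refine ind fun N hN => ?_
      have h := ZornMatrix.conj_mul_mul M.conj N hc
      rw [ZornMatrix.conj_conj] at h
      simp only [mk_mul_mk, h]
  bijective_mul_right := ind fun M hM => by
    have hc : M.conj.det = 1 := by rw [ZornMatrix.det_conj, hM]
    refine Function.bijective_iff_has_inverse.2 ⟨fun x => x * mk M.conj hc, ?_, ?_⟩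
    · refine ind fun N hN => ?_
      simp only [mk_mul_mk, ZornMatrix.mul_mul_conj M N hM]
    · refine ind fun N hN => ?_
      have h := ZornMatrix.mul_mul_conj M.conj N hc
      rw [ZornMatrix.conj_conj] at h
      simp only [mk_mul_mk, h]

end PaigeLoop

/-!
Let `T` be a subloop containing the three given elements and call a Zorn matrix of determinant `1`
*in* `T` when its class is. For each coordinate `i` the scalars `t` for which the elementary matrix
`upper (t eᵢ)` is in `T` form an additive group `Aᵢ`, and those for which `lower (t eᵢ)` is in `T`
form an additive group `Bᵢ`. If all of these are the whole field, then `T` is everything: all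
`upper α` and `lower β` are in `T` (`upper_mem`, `lower_mem`), every matrix with upper left entry
`1` is a product `lower β * upper α`, and every matrix can be brought to that form by right
multiplication with elementary matrices (`mem_of_det_eq_one`).

In odd characteristic a commutator computation gives `Aᵢ Aⱼ ⊆ Bₖ` and `Bᵢ Bⱼ ⊆ Aₖ` for distinct
`i, j, k`; this is where nonassociativity does the work, since the three-dimensional cross product
multiplies scalars. From `1 ∈ A₀` and `1 ∈ A₁` one gets `1 ∈ B₂`, and conjugating `lower e₂` by the
third generator gives `λ² ∈ A₂`. The product rules then spread `λ²` to all six groups. Their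
intersection is closed under addition and multiplication and contains all `λ ^ (2 m)` with
`m > 0`, hence all nonzero squares; as every element is a difference of two squares, it is the whole
field. No classification of the subgroups of `SL₂(q)` is needed.

For `q = 2` the commutators vanish, and the elementary matrices are written as explicit words in
the generators.
-/

namespace ZornMatrix

variable {F : Type*} [Field F]

/-! ### Elementary matrices -/

/-- The upper unitriangular Zorn matrix with vector `v`. -/
def upper (v : Fin 3 → F) : ZornMatrix F := { a := 1, α := v, β := 0, b := 1 }

/-- The lower unitriangular Zorn matrix with vector `v`. -/
def lower (v : Fin 3 → F) : ZornMatrix F := { a := 1, α := 0, β := v, b := 1 }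

/-- The Zorn matrix with rows `(0, c eᵢ)` and `(-c⁻¹ eᵢ, 1)`. -/
def mixed (c : F) (i : Fin 3) : ZornMatrix F :=
  { a := 0, α := Pi.single i c, β := -Pi.single i c⁻¹, b := 1 }

theorem upper_zero : upper (0 : Fin 3 → F) = 1 := rfl

theorem lower_zero : lower (0 : Fin 3 → F) = 1 := rfl

theorem conj_upper (v : Fin 3 → F) : (upper v).conj = upper (-v) := by
  simp [upper, conj]

theorem conj_lower (v : Fin 3 → F) : (lower v).conj = lower (-v) := by
  simp [lower, conj]

theorem upper_mul_upper (v w : Fin 3 → F) :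
    upper v * upper w = { a := 1, α := v + w, β := v ⨯₃ w, b := 1 } := by
  simp [upper, mul_def, add_comm]

theorem lower_mul_lower (v w : Fin 3 → F) :
    lower v * lower w = { a := 1, α := -(v ⨯₃ w), β := v + w, b := 1 } := by
  simp [lower, mul_def]

theorem lower_mul_upper (v w : Fin 3 → F) :
    lower v * upper w = { a := 1, α := w, β := v, b := v ⬝ᵥ w + 1 } := by
  simp [lower, upper, mul_def]

theorem upper_commutator (v w : Fin 3 → F) :
    ((upper w).conj * (upper v * upper w)) * (upper v).conj = lower (2 • v ⨯₃ w) := by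
  rw [upper_mul_upper, conj_upper, conj_upper]
  ext i
  · simp [upper, lower, mul_def]
  · simp [upper, lower, mul_def]
  · fin_cases i <;> simp [upper, lower, mul_def, cross_apply] <;> ring
  · simp [upper, lower, mul_def, cross_apply, dotProduct, Fin.sum_univ_three]
    ring

theorem lower_commutator (v w : Fin 3 → F) :
    ((lower w).conj * (lower v * lower w)) * (lower v).conj = upper (-(2 • v ⨯₃ w)) := by
  rw [lower_mul_lower, conj_lower, conj_lower]
  ext i
  · simp [upper, lower, mul_def, cross_apply, dotProduct, Fin.sum_univ_three]
    ring
  · fin_cases i <;> simp [upper, lower, mul_def, cross_apply] <;> ring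
  · simp [upper, lower, mul_def]
  · simp [upper, lower, mul_def]

theorem single_cross_single (i : Fin 3) (s t : F) :
    (Pi.single i s) ⨯₃ (Pi.single (i + 1) t) = Pi.single (i + 2) (s * t) := by
  ext j
  fin_cases i <;> fin_cases j <;> simp [cross_apply]

theorem single_cross_single_self (i : Fin 3) (s t : F) :
    (Pi.single i s : Fin 3 → F) ⨯₃ (Pi.single i t) = 0 := by
  ext j
  fin_cases i <;> fin_cases j <;> simp [cross_apply]

theorem eq_sum_single (v : Fin 3 → F) :
    v = Pi.single 0 (v 0) + Pi.single 1 (v 1) + Pi.single 2 (v 2) := by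
  ext j
  fin_cases j <;> simp

theorem single_zero (c : F) : (Pi.single 0 c : Fin 3 → F) = ![c, 0, 0] := by
  ext j
  fin_cases j <;> simp

theorem single_one (c : F) : (Pi.single 1 c : Fin 3 → F) = ![0, c, 0] := by
  ext j
  fin_cases j <;> simp

theorem single_two (c : F) : (Pi.single 2 c : Fin 3 → F) = ![0, 0, c] := by
  ext j
  fin_cases j <;> simp

/-- Up to sign, conjugation by `mixed c 2` turns a lower elementary matrix into an upper one and
introduces the factor `c ^ 2`; the cube of `mixed c 2` is `-1`, so its square inverts it up to sign. -/
theorem mixed_mul_lower_mul_mixed (c : F) (hc : c ≠ 0) :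
    ((mixed c 2 * mixed c 2) * lower (Pi.single 2 1)) * mixed c 2
      = -upper (-Pi.single 2 (c ^ 2)) := by
  simp [upper, lower, mixed, mul_def, neg_def, single_two, cross_apply, hc]
  ring

/-! ### Subloops of matrices of determinant one -/

/-- A set of Zorn matrices of determinant `1` that is the full preimage of a subloop of the Paige
loop. Since `conj` inverts matrices of determinant `1`, the divisions are expressed by it. -/
structure IsUnimodularSubloop (S : Set (ZornMatrix F)) : Prop where
  det_eq_one : ∀ ⦃M⦄, M ∈ S → det M = 1
  one_mem : 1 ∈ S
  mul_mem : ∀ ⦃M N⦄, M ∈ S → N ∈ S → M * N ∈ S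
  conj_mem : ∀ ⦃M⦄, M ∈ S → M.conj ∈ S
  neg_mem : ∀ ⦃M⦄, M ∈ S → -M ∈ S

namespace IsUnimodularSubloop

variable {S : Set (ZornMatrix F)} (hS : IsUnimodularSubloop S)

theorem mem_of_mul_mem_right (h : IsUnimodularSubloop S) {M N : ZornMatrix F} (hN : N ∈ S)
    (hMN : M * N ∈ S) : M ∈ S := by
  rw [← mul_mul_conj N M (h.det_eq_one hN)]
  exact h.mul_mem hMN (h.conj_mem hN)

/-- The scalars `t` for which `upper (t eᵢ)` lies in the subloop. -/
def upperGroup (i : Fin 3) : AddSubgroup F where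
  carrier := {t | upper (Pi.single i t) ∈ S}
  zero_mem' := by simpa [upper_zero] using hS.one_mem
  add_mem' {s t} hs ht := by
    have h := hS.mul_mem hs ht
    rw [upper_mul_upper, single_cross_single_self, ← Pi.single_add] at h
    exact h
  neg_mem' {t} ht := by
    have h := hS.conj_mem ht
    rw [conj_upper, ← Pi.single_neg] at h
    exact h

/-- The scalars `t` for which `lower (t eᵢ)` lies in the subloop. -/
def lowerGroup (i : Fin 3) : AddSubgroup F where
  carrier := {t | lower (Pi.single i t) ∈ S}
  zero_mem' := by simpa [lower_zero] using hS.one_mem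
  add_mem' {s t} hs ht := by
    have h := hS.mul_mem hs ht
    rw [lower_mul_lower, single_cross_single_self, neg_zero, ← Pi.single_add] at h
    exact h
  neg_mem' {t} ht := by
    have h := hS.conj_mem ht
    rw [conj_lower, ← Pi.single_neg] at h
    exact h

/-! ### Elementary matrices generate -/

/-- The correction factor `lower (-(v ⨯₃ w))` turns `upper v * upper w` into `upper (v + w)`. -/
theorem upper_add_mem (h : IsUnimodularSubloop S) {v w : Fin 3 → F} (hv : upper v ∈ S)
    (hw : upper w ∈ S) (hvw : lower (v ⨯₃ w) ∈ S) : upper (v + w) ∈ S := by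
  have key : upper v * upper w = upper (v + w) * lower (v ⨯₃ w) := by
    rw [upper_mul_upper]
    simp [upper, lower, mul_def]
  exact h.mem_of_mul_mem_right hvw (key ▸ h.mul_mem hv hw)

theorem lower_add_mem (h : IsUnimodularSubloop S) {v w : Fin 3 → F} (hv : lower v ∈ S)
    (hw : lower w ∈ S) (hvw : upper (-(v ⨯₃ w)) ∈ S) : lower (v + w) ∈ S := by
  have key : lower v * lower w = lower (v + w) * upper (-(v ⨯₃ w)) := by
    rw [lower_mul_lower]
    simp [upper, lower, mul_def]
  exact h.mem_of_mul_mem_right hvw (key ▸ h.mul_mem hv hw)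

theorem upper_mem (h : IsUnimodularSubloop S) (hU : ∀ i t, upper (Pi.single i t) ∈ S)
    (hL : ∀ i t, lower (Pi.single i t) ∈ S) (v : Fin 3 → F) : upper v ∈ S := by
  rw [eq_sum_single v]
  refine h.upper_add_mem (h.upper_add_mem (hU 0 _) (hU 1 _) ?_) (hU 2 _) ?_
  · have := single_cross_single 0 (v 0) (v 1)
    rw [zero_add] at this
    rw [this]
    exact hL _ _
  -- The cross product with `e₂` lies in the plane of `e₀` and `e₁`.
  · have : (Pi.single 0 (v 0) + Pi.single 1 (v 1) : Fin 3 → F) ⨯₃ (Pi.single 2 (v 2))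
        = Pi.single 0 (v 1 * v 2) + Pi.single 1 (-(v 0 * v 2)) := by
      ext j
      fin_cases j <;> simp [cross_apply]
    rw [this]
    refine h.lower_add_mem (hL 0 _) (hL 1 _) ?_
    have := single_cross_single 0 (v 1 * v 2) (-(v 0 * v 2))
    rw [zero_add] at this
    rw [this, ← Pi.single_neg]
    exact hU _ _

theorem lower_mem (h : IsUnimodularSubloop S) (hU : ∀ i t, upper (Pi.single i t) ∈ S)
    (hL : ∀ i t, lower (Pi.single i t) ∈ S) (v : Fin 3 → F) : lower v ∈ S := by
  have hU' := h.upper_mem hU hL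
  rw [eq_sum_single v]
  exact h.lower_add_mem (h.lower_add_mem (hL 0 _) (hL 1 _) (hU' _)) (hL 2 _) (hU' _)

/-- A unimodular subloop containing the elementary matrices in the coordinate directions contains all
matrices of determinant `1`. -/
theorem mem_of_det_eq_one (h : IsUnimodularSubloop S) (hU : ∀ i t, upper (Pi.single i t) ∈ S)
    (hL : ∀ i t, lower (Pi.single i t) ∈ S) {M : ZornMatrix F} (hM : M.det = 1) : M ∈ S := by
  have hU' := h.upper_mem hU hL
  have hL' := h.lower_mem hU hL
  have of_a_eq_one : ∀ N : ZornMatrix F, N.det = 1 → N.a = 1 → N ∈ S := by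
    intro N hN ha
    have key : N = lower N.β * upper N.α := by
      rw [det, ha] at hN
      rw [lower_mul_upper]
      ext
      · exact ha
      · rfl
      · rfl
      · rw [dotProduct_comm]
        linear_combination hN
    rw [key]
    exact h.mul_mem (hL' _) (hU' _)
  -- If some coordinate of `α` is nonzero, a lower elementary factor makes the entry `a` equal to `1`.
  have of_α_ne_zero : ∀ N : ZornMatrix F, N.det = 1 → ∀ i, N.α i ≠ 0 → N ∈ S := by
    intro N hN i hi
    have hl := hL' (Pi.single i ((1 - N.a) / N.α i))
    refine h.mem_of_mul_mem_right hl (of_a_eq_one _ ?_ ?_)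
    · rw [det_mul, hN, h.det_eq_one hl, one_mul]
    · simp [mul_def, lower, mul_div_cancel₀ _ hi]
  by_cases hα : M.α = 0
  -- If `α = 0`, then `a ≠ 0`, and an upper elementary factor makes `α` nonzero.
  · have ha : M.a ≠ 0 := by
      rintro ha
      simp [det, hα, ha] at hM
    have hu := hU' (Pi.single 0 1)
    refine h.mem_of_mul_mem_right hu (of_α_ne_zero _ ?_ 0 ?_)
    · rw [det_mul, hM, h.det_eq_one hu, one_mul]
    · simpa [mul_def, upper, hα] using ha
  · obtain ⟨i, hi⟩ := Function.ne_iff.1 hα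
    exact of_α_ne_zero M hM i hi

/-! ### Odd characteristic -/

/-- Doubling is invertible on a finite group of odd order, by a multiple of the identity. -/
theorem _root_.AddSubgroup.mem_of_two_nsmul_mem_of_odd_card {G : Type*} [AddCommGroup G]
    [Fintype G] (hodd : Odd (Fintype.card G)) (A : AddSubgroup G) {t : G} (ht : 2 • t ∈ A) :
    t ∈ A := by
  obtain ⟨k, hk⟩ := hodd
  have h : (k + 1) • 2 • t = t := by
    rw [← mul_nsmul, show 2 * (k + 1) = Fintype.card G + 1 by omega, succ_nsmul,
      card_nsmul_eq_zero, zero_add]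
  exact h ▸ A.nsmul_mem ht (k + 1)

/-- The commutator of elementary matrices in two coordinates yields twice the product, which can be
halved because the characteristic is odd. -/
theorem mul_mem_lowerGroup [Fintype F] (hodd : Odd (Fintype.card F)) (i : Fin 3) {s t : F}
    (hs : s ∈ hS.upperGroup i) (ht : t ∈ hS.upperGroup (i + 1)) :
    s * t ∈ hS.lowerGroup (i + 2) := by
  refine AddSubgroup.mem_of_two_nsmul_mem_of_odd_card hodd _ ?_
  have h := hS.mul_mem (hS.mul_mem (hS.conj_mem ht) (hS.mul_mem hs ht)) (hS.conj_mem hs)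
  rw [upper_commutator, single_cross_single, ← Pi.single_smul] at h
  exact h

theorem mul_mem_upperGroup [Fintype F] (hodd : Odd (Fintype.card F)) (i : Fin 3) {s t : F}
    (hs : s ∈ hS.lowerGroup i) (ht : t ∈ hS.lowerGroup (i + 1)) :
    s * t ∈ hS.upperGroup (i + 2) := by
  refine AddSubgroup.mem_of_two_nsmul_mem_of_odd_card hodd _ ?_
  rw [← neg_mem_iff]
  have h := hS.mul_mem (hS.mul_mem (hS.conj_mem ht) (hS.mul_mem hs ht)) (hS.conj_mem hs)
  rw [lower_commutator, single_cross_single, ← Pi.single_smul, ← Pi.single_neg] at h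
  exact h

/-- The scalars `t` such that `upper (t eᵢ)` and `lower (t eᵢ)` lie in the subloop for all `i`. -/
def commonGroup : AddSubgroup F := ⨅ i, hS.upperGroup i ⊓ hS.lowerGroup i

theorem mem_commonGroup {t : F} :
    t ∈ hS.commonGroup ↔ ∀ i, t ∈ hS.upperGroup i ∧ t ∈ hS.lowerGroup i := by
  simp [commonGroup, AddSubgroup.mem_iInf, AddSubgroup.mem_inf]

theorem mul_mem_commonGroup [Fintype F] (hodd : Odd (Fintype.card F)) {s t : F}
    (hs : s ∈ hS.commonGroup) (ht : t ∈ hS.commonGroup) : s * t ∈ hS.commonGroup := by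
  rw [mem_commonGroup] at *
  intro i
  have hi : i + 1 + 2 = i := by fin_cases i <;> rfl
  have hu := hS.mul_mem_upperGroup hodd (i + 1) (hs _).2 (ht _).2
  have hl := hS.mul_mem_lowerGroup hodd (i + 1) (hs _).1 (ht _).1
  rw [hi] at hu hl
  exact ⟨hu, hl⟩

/-- Every element of a field of odd order is a difference of two squares. -/
theorem _root_.AddSubgroup.eq_top_of_squares_mem [Fintype F] (hodd : Odd (Fintype.card F))
    (A : AddSubgroup F) (hA : ∀ t : F, t ^ 2 ∈ A) : A = ⊤ := by
  have h2 : (2 : F) ≠ 0 := by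
    refine Ring.two_ne_zero fun h => ?_
    have := FiniteField.even_card_of_char_two h
    exact (Nat.not_even_iff_odd.2 hodd) (Nat.even_iff.2 this)
  refine (AddSubgroup.eq_top_iff' A).2 fun t => ?_
  have h := A.sub_mem (hA ((t + 1) / 2)) (hA ((t - 1) / 2))
  have : ((t + 1) / 2) ^ 2 - ((t - 1) / 2) ^ 2 = t := by
    field_simp
    ring
  rwa [this] at h

theorem commonGroup_eq_top [Fintype F] (hodd : Odd (Fintype.card F)) {c : Fˣ}
    (hc : ∀ x : Fˣ, x ∈ Subgroup.zpowers c) (h0 : upper (Pi.single 0 1) ∈ S)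
    (h1 : upper (Pi.single 1 1) ∈ S) (h2 : mixed (c : F) 2 ∈ S) : hS.commonGroup = ⊤ := by
  have hl2 : (1 : F) ∈ hS.lowerGroup 2 := by
    simpa using hS.mul_mem_lowerGroup hodd 0 (s := 1) (t := 1) h0 h1
  have hu2 : (c : F) ^ 2 ∈ hS.upperGroup 2 := by
    have h := hS.neg_mem (hS.mul_mem (hS.mul_mem (hS.mul_mem h2 h2) hl2) h2)
    rw [mixed_mul_lower_mul_mixed _ c.ne_zero, neg_neg, ← Pi.single_neg] at h
    exact neg_mem_iff.1 h
  -- The product rules carry `c ^ 2` from one group to all six.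
  have hl0 : (c : F) ^ 2 ∈ hS.lowerGroup 0 := by
    simpa using hS.mul_mem_lowerGroup hodd 1 (s := 1) h1 hu2
  have hl1 : (c : F) ^ 2 ∈ hS.lowerGroup 1 := by
    simpa using hS.mul_mem_lowerGroup hodd 2 (t := 1) hu2 h0
  have hu0 : (c : F) ^ 2 ∈ hS.upperGroup 0 := by
    simpa using hS.mul_mem_upperGroup hodd 1 (t := 1) hl1 hl2
  have hu1 : (c : F) ^ 2 ∈ hS.upperGroup 1 := by
    simpa using hS.mul_mem_upperGroup hodd 2 (s := 1) hl2 hl0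
  have hl2' : (c : F) ^ 2 ∈ hS.lowerGroup 2 := by
    simpa using hS.mul_mem_lowerGroup hodd 0 (t := 1) hu0 h1
  have hmem : (c : F) ^ 2 ∈ hS.commonGroup := by
    rw [mem_commonGroup]
    intro i
    fin_cases i
    exacts [⟨hu0, hl0⟩, ⟨hu1, hl1⟩, ⟨hu2, hl2'⟩]
  have hpow : ∀ n : ℕ, ((c : F) ^ 2) ^ (n + 1) ∈ hS.commonGroup := by
    intro n
    induction n with
    | zero => simpa using hmem
    | succ n ih =>
      rw [pow_succ]
      exact hS.mul_mem_commonGroup hodd ih hmem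
  refine AddSubgroup.eq_top_of_squares_mem hodd _ fun t => ?_
  rcases eq_or_ne t 0 with rfl | ht
  · simp
  -- Dividing by `c` first makes the exponent positive, as `hpow` requires.
  · obtain ⟨n, hn⟩ := mem_powers_iff_mem_zpowers.2 (hc (Units.mk0 t ht * c⁻¹))
    have hn' : (c : F) ^ (n + 1) = t := by
      have := congrArg (Units.val) (eq_mul_inv_iff_mul_eq.1 hn)
      simpa [pow_succ] using this
    rw [← hn', ← pow_mul, mul_comm, pow_mul]
    exact hpow n

/-! ### The field with two elements -/

theorem upper_two_eq_word (h2 : (2 : F) = 0) :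
    (upper (Pi.single 0 1) * (mixed 1 2 * upper (Pi.single 1 1))) *
        ((upper (Pi.single 1 1) * (mixed 1 2 * upper (Pi.single 0 1))) * mixed 1 2)
      = upper (Pi.single 2 (1 : F)) := by
  have hadd : (1 : F) + 1 = 0 := by linear_combination h2
  have hneg : (-1 : F) = 1 := by linear_combination -h2
  simp [upper, mixed, mul_def, single_zero, single_one, single_two, cross_apply, hadd, hneg]

theorem lower_zero_eq_word (h2 : (2 : F) = 0) :
    (mixed 1 2 * mixed 1 2) * (upper (Pi.single 1 1) * mixed 1 2)
      = lower (Pi.single 0 (1 : F)) := by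
  have hadd : (1 : F) + 1 = 0 := by linear_combination h2
  have hneg : (-1 : F) = 1 := by linear_combination -h2
  simp [upper, lower, mixed, mul_def, single_zero, single_one, single_two, cross_apply, hadd, hneg]

theorem lower_one_eq_word (h2 : (2 : F) = 0) :
    (mixed 1 2 * mixed 1 2) * (upper (Pi.single 0 1) * mixed 1 2)
      = lower (Pi.single 1 (1 : F)) := by
  have hadd : (1 : F) + 1 = 0 := by linear_combination h2
  have hneg : (-1 : F) = 1 := by linear_combination -h2
  simp [upper, lower, mixed, mul_def, single_zero, single_one, single_two, cross_apply, hadd, hneg]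

theorem lower_two_eq_word (h2 : (2 : F) = 0) :
    (mixed 1 2 * upper (Pi.single 2 1)) * (mixed 1 2 * mixed 1 2)
      = lower (Pi.single 2 (1 : F)) := by
  have hadd : (1 : F) + 1 = 0 := by linear_combination h2
  have hneg : (-1 : F) = 1 := by linear_combination -h2
  simp [upper, lower, mixed, mul_def, single_two, cross_apply, hadd, hneg]

theorem commonGroup_eq_top_of_card_eq_two [Fintype F] (hcard : Fintype.card F = 2)
    (h0 : upper (Pi.single 0 1) ∈ S) (h1 : upper (Pi.single 1 1) ∈ S)
    (h2 : mixed (1 : F) 2 ∈ S) : hS.commonGroup = ⊤ := by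
  have htwo : (2 : F) = 0 := by
    have := FiniteField.cast_card_eq_zero F
    rwa [hcard] at this
  have hu2 : upper (Pi.single 2 (1 : F)) ∈ S := by
    rw [← upper_two_eq_word htwo]
    exact hS.mul_mem (hS.mul_mem h0 (hS.mul_mem h2 h1))
      (hS.mul_mem (hS.mul_mem h1 (hS.mul_mem h2 h0)) h2)
  have hl0 : lower (Pi.single 0 (1 : F)) ∈ S := by
    rw [← lower_zero_eq_word htwo]
    exact hS.mul_mem (hS.mul_mem h2 h2) (hS.mul_mem h1 h2)
  have hl1 : lower (Pi.single 1 (1 : F)) ∈ S := by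
    rw [← lower_one_eq_word htwo]
    exact hS.mul_mem (hS.mul_mem h2 h2) (hS.mul_mem h0 h2)
  have hl2 : lower (Pi.single 2 (1 : F)) ∈ S := by
    rw [← lower_two_eq_word htwo]
    exact hS.mul_mem (hS.mul_mem h2 hu2) (hS.mul_mem h2 h2)
  have hone : (1 : F) ∈ hS.commonGroup := by
    rw [mem_commonGroup]
    intro i
    fin_cases i
    exacts [⟨h0, hl0⟩, ⟨h1, hl1⟩, ⟨hu2, hl2⟩]
  refine (AddSubgroup.eq_top_iff' _).2 fun t => ?_
  have ht : t = 0 ∨ t = 1 := by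
    have h := FiniteField.pow_card t
    rw [hcard] at h
    have : t * (t - 1) = 0 := by linear_combination h
    simpa [sub_eq_zero] using this
  rcases ht with rfl | rfl
  exacts [zero_mem _, hone]

end IsUnimodularSubloop

end ZornMatrix

/-! ### Subloops of the Paige loop -/

open ZornMatrix

/-- The Zorn matrices of determinant `1` whose class lies in a given subset of the Paige loop. -/
def PaigeLoop.preimage {F : Type*} [Field F] (T : Set (PaigeLoop F)) : Set (ZornMatrix F) :=
  {M | ∃ hM : M.det = 1, PaigeLoop.mk M hM ∈ T}

theorem IsSubloop.isUnimodularSubloop_preimage {F : Type*} [Field F] {T : Set (PaigeLoop F)}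
    (hT : IsSubloop T) : IsUnimodularSubloop (PaigeLoop.preimage T) where
  det_eq_one := fun _ ⟨h, _⟩ => h
  one_mem := ⟨det_one, hT.one_mem⟩
  mul_mem := fun M N ⟨hM, h⟩ ⟨hN, k⟩ =>
    ⟨by rw [det_mul, hM, hN, one_mul], hT.mul_mem h k⟩
  conj_mem := fun M ⟨hM, h⟩ => by
    have hc : M.conj.det = 1 := by rw [det_conj, hM]
    refine ⟨hc, hT.right_div_mem h hT.one_mem ?_⟩
    rw [PaigeLoop.mk_mul_mk, PaigeLoop.one_def, PaigeLoop.mk_eq_mk_iff]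
    left
    simpa only [mul_one'] using conj_mul_mul M 1 hM
  neg_mem := fun M ⟨hM, h⟩ => by
    have hn : (-M).det = 1 := by rw [det_neg, hM]
    refine ⟨hn, ?_⟩
    rwa [(PaigeLoop.mk_eq_mk_iff (-M) M hn hM).2 (Or.inr rfl)]

theorem mainTheorem5 {F : Type*} [Field F] [Fintype F]
    (hq : (Odd (Fintype.card F) ∧ Fintype.card F ≠ 9) ∨ Fintype.card F = 2)
    (lam : Fˣ) (hlam : ∀ x : Fˣ, x ∈ Subgroup.zpowers lam) :
    subloopClosure
      ({PaigeLoop.mk (F := F) { a := 1, α := Pi.single 0 1, β := 0, b := 1 }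
          (ZornMatrix.det_upper (Pi.single 0 1)),
        PaigeLoop.mk (F := F) { a := 1, α := Pi.single 1 1, β := 0, b := 1 }
          (ZornMatrix.det_upper (Pi.single 1 1)),
        PaigeLoop.mk (F := F)
          { a := 0, α := Pi.single 2 (lam : F), β := -Pi.single 2 ((lam⁻¹ : Fˣ) : F), b := 1 }
          (ZornMatrix.det_mixed lam 2)} : Set (PaigeLoop F)) = Set.univ := by
  refine Set.eq_univ_of_forall fun x T hT => ?_
  have hS := hT.1.isUnimodularSubloop_preimage
  have h0 : upper (Pi.single 0 1) ∈ PaigeLoop.preimage T := ⟨det_upper _, hT.2 (by simp [upper])⟩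
  have h1 : upper (Pi.single 1 1) ∈ PaigeLoop.preimage T := ⟨det_upper _, hT.2 (by simp [upper])⟩
  have h2 : mixed (lam : F) 2 ∈ PaigeLoop.preimage T := by
    rw [mixed, ← Units.val_inv_eq_inv_val]
    exact ⟨det_mixed lam 2, hT.2 (by simp)⟩
  have htop : hS.commonGroup = ⊤ := by
    rcases hq with ⟨hodd, -⟩ | hcard
    · exact hS.commonGroup_eq_top hodd hlam h0 h1 h2
    · have hlam1 : lam = 1 := by
        classical
        have : Fintype.card Fˣ = 1 := by rw [Fintype.card_units, hcard]
        exact (Fintype.card_le_one_iff.1 this.le) _ _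
      rw [hlam1, Units.val_one] at h2
      exact hS.commonGroup_eq_top_of_card_eq_two hcard h0 h1 h2
  have hmem : ∀ i t, t ∈ hS.upperGroup i ∧ t ∈ hS.lowerGroup i := fun i t =>
    hS.mem_commonGroup.1 (htop ▸ AddSubgroup.mem_top t) i
  induction x using PaigeLoop.ind with
  | h M hM =>
    exact (hS.mem_of_det_eq_one (fun i t => (hmem i t).1) (fun i t => (hmem i t).2) hM).2
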